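/- Let $\gamma>0$ and, for an integer $d\ge 2$, let $\mathcal L:\mathcal M_d\to\mathcal M_d$, $\mathcal L(f)=\gamma\left(\operatorname{tr}(f)\,\tfrac{\mathbb 1}{d}-f\right)$, be the generator of the completely depolarizing semigroup on the complex $d\times d$ matrices. It is a Liouvillian (of Lindblad form) whose unique stationary state is the full-rank state $\sigma=\mathbb 1/d$. With $\Gamma_\sigma^{s}(f)=\sigma^{s/2}f\sigma^{s/2}$, $\langle f,g\rangle_\sigma=\operatorname{tr}(\Gamma_\sigma(f)g)$ and $\|f\|_{2,\sigma}^2=\langle f,f\rangle_\sigma$ put, for positive definite $f$, $$\mathcal E_2(f)=-\langle f,\mathcal L(f)\rangle_\sigma,$$ $$\mathrm{Ent}_2(f)=\operatorname{tr}\left[(\Gamma_\sigma^{1/2}(f))^2\log \Gamma_\sigma^{1/2}(f)\right]-\tfrac12\operatorname{tr}\left[(\Gamma_\sigma^{1/2}(f))^2\log\sigma\right]-\tfrac12\|f\|_{2,\sigma}^2\log\|f\|_{2,\sigma}^2 .$$ Let $\alpha_2$ be the $LS_2$ constant of $\mathcal L$, i.e. the largest $\alpha>0$ such that $\alpha\,\mathrm{Ent}_2(f)\le\mathcal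 E_2(f)$ for all positive definite $f\in\mathcal M_d$. Then this largest constant exists and $$\alpha_2=\frac{2\gamma(1-2/d)}{\log(d-1)}\quad\text{for } d\ge 3,\qquad \alpha_2=\gamma\quad\text{for } d=2 .$$ The value at $d=2$ is the limit of the formula: $\lim_{x\to 2}\frac{2\gamma(1-2/x)}{\log(x-1)}=\gamma$ over real $x\neq 2$. -/

import Mathlib

open Filter Topology
open scoped ComplexOrder

namespace QuantumLS

noncomputable section

/-- The algebra `M_d` of complex `d × d` matrices. -/
abbrev Md (d : ℕ) : Type := Matrix (Fin d) (Fin d) ℂ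

/-- The set `S_d` of states: positive semidefinite matrices of trace one. -/
def IsState {d : ℕ} (ρ : Md d) : Prop := ρ.PosSemidef ∧ ρ.trace = 1

/-- `Γ_σ^s (f) = σ^{s/2} f σ^{s/2}`; real functions of a Hermitian matrix are taken by the
continuous functional calculus, i.e. they act on the eigenvalues. -/
def Gam {d : ℕ} (σ : Md d) (s : ℝ) (f : Md d) : Md d :=
  cfc (fun x : ℝ => x ^ (s / 2)) σ * f * cfc (fun x : ℝ => x ^ (s / 2)) σ

/-- The weighted norm `‖f‖_{p,σ} = (tr |Γ_σ^{1/p}(f)|^p)^{1/p}` (for Hermitian `f`). -/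
def lpNorm {d : ℕ} (σ : Md d) (p : ℝ) (f : Md d) : ℝ :=
  ((cfc (fun x : ℝ => |x| ^ p) (Gam σ (1 / p) f)).trace.re) ^ (1 / p)

/-- The weighted inner product `⟨f, g⟩_σ = tr (Γ_σ(f) g)`, which is real for Hermitian `f, g`. -/
def lpInner {d : ℕ} (σ f g : Md d) : ℝ := (Gam σ 1 f * g).trace.re

/-- The power operator `I_{p,q}(f) = Γ_σ^{-1/p} [ |Γ_σ^{1/q}(f)|^{q/p} ]` (for Hermitian `f`). -/
def powerOp {d : ℕ} (σ : Md d) (p q : ℝ) (f : Md d) : Md d :=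
  Gam σ (-(1 / p)) (cfc (fun x : ℝ => |x| ^ (q / p)) (Gam σ (1 / q) f))

/-- The operator valued relative entropy
`S_p(f) = Γ_σ^{-1/p} [Γ_σ^{1/p}(f) log Γ_σ^{1/p}(f)] - (1/2p) {f, log σ}`
(for positive definite `f`). -/
def opEnt {d : ℕ} (σ : Md d) (p : ℝ) (f : Md d) : Md d :=
  Gam σ (-(1 / p)) (Gam σ (1 / p) f * cfc Real.log (Gam σ (1 / p) f))
    - (1 / (2 * p)) • (f * cfc Real.log σ + cfc Real.log σ * f)

/-- The `L_p` relative entropy, `1 < p`, with `q = p / (p - 1)` the conjugate exponent: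
`Ent_p(f) = ⟨I_{q,p}(f), S_p(f)⟩_σ - ‖f‖_{p,σ}^p log ‖f‖_{p,σ}`. -/
def Ent {d : ℕ} (σ : Md d) (p : ℝ) (f : Md d) : ℝ :=
  lpInner σ (powerOp σ (p / (p - 1)) p f) (opEnt σ p f)
    - lpNorm σ p f ^ p * Real.log (lpNorm σ p f)

/-- The `L_p` Dirichlet form, `1 < p`, with `q = p / (p - 1)` the conjugate exponent:
`E_p(f) = - p / (2 (p - 1)) ⟨I_{q,p}(f), L(f)⟩_σ`. -/
def dirichletForm {d : ℕ} (L : Md d →ₗ[ℂ] Md d) (σ : Md d) (p : ℝ) (f : Md d) : ℝ :=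
  -p / (2 * (p - 1)) * lpInner σ (powerOp σ (p / (p - 1)) p f) (L f)

/-- Liouvillians: generators (in the Heisenberg picture) in Lindblad form
`L(f) = i[H, f] + ∑ₖ (Aₖ† f Aₖ - ½ {Aₖ† Aₖ, f})`. -/
def IsLiouvillian {d : ℕ} (L : Md d →ₗ[ℂ] Md d) : Prop :=
  ∃ (H : Md d) (n : ℕ) (A : Fin n → Md d), H.IsHermitian ∧ ∀ f : Md d,
    L f = Complex.I • (H * f - f * H) +
      ∑ k, ((A k).conjTranspose * f * A k -
        (1 / 2 : ℂ) • ((A k).conjTranspose * A k * f + f * ((A k).conjTranspose * A k)))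

/-- `L^*(ρ) = 0`, where `L^*` is the dual of `L` for the Hilbert-Schmidt inner product. -/
def IsStationaryState {d : ℕ} (L : Md d →ₗ[ℂ] Md d) (ρ : Md d) : Prop :=
  ∀ f : Md d, (ρ * L f).trace = 0

/-- `L` is primitive with stationary state `σ`: the state `σ` has full rank, is stationary, and is
the only stationary state. -/
def IsPrimitiveAt {d : ℕ} (L : Md d →ₗ[ℂ] Md d) (σ : Md d) : Prop :=
  IsState σ ∧ σ.PosDef ∧ IsStationaryState L σ ∧ ∀ ρ : Md d, IsState ρ → IsStationaryState L ρ → ρ = σ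

/-- `α` is the `LS_p` constant of `L` (`1 < p`): `L` is a primitive Liouvillian, and for the
entropy and the Dirichlet form weighted by its stationary state `σ`, `α` is the largest positive
number with `α Ent_p(f) ≤ E_p(f)` for all positive definite `f`. -/
def IsLSConstant {d : ℕ} (L : Md d →ₗ[ℂ] Md d) (p α : ℝ) : Prop :=
  IsLiouvillian L ∧ ∃ σ : Md d, IsPrimitiveAt L σ ∧
    IsGreatest {a : ℝ | 0 < a ∧ ∀ f : Md d, f.PosDef → a * Ent σ p f ≤ dirichletForm L σ p f} α

/-- The generator of the completely depolarizing semigroup, `L(f) = γ (tr(f) 1/d - f)`. -/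
def depolarizing (d : ℕ) (γ : ℝ) : Md d →ₗ[ℂ] Md d where
  toFun f := (γ : ℂ) • ((f.trace / (d : ℂ)) • (1 : Md d) - f)
  map_add' f g := by
    rw [Matrix.trace_add, add_div, add_smul, ← smul_add]
    congr 1
    abel
  map_smul' c f := by
    rw [Matrix.trace_smul, smul_eq_mul, mul_div_assoc, mul_smul, ← smul_sub,
      smul_comm, RingHom.id_apply]

end

end QuantumLS

open QuantumLS

/-! Since `maxMixed d` is scalar, entropy and Dirichlet form depend only on the eigenvalues
(`Ent_two_maxMixed`, `dirichletForm_depolarizing`). Diagonal matrices realise all positive spectra,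
so the problem is the classical log-Sobolev inequality for the uniform measure on `d` points.

The core is the two-point inequality with weights `1 : m`. With `T = log m / 2` its deficit is a
one-variable function, even in `t`; for `t ≥ 0` convexity of `sinh` makes it decrease up to `t = T`
and increase after, and it vanishes there (`twoPointDeficit_nonneg`).

`uniform_logSobolev` inducts on the number of points. The largest value is split off and the others
are replaced by their root mean square: entropy splits exactly, while maximality ensures the
variance is at least the sum of the two parts. The constant `tanhc T` decreases in `T`, so the
hypothesis for fewer points suffices.

The zero of the deficit at `t = -T` yields the extremal vector `(d - 1, 1, ..., 1)`. For `d = 2`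
this is constant, and sharpness comes from perturbing constants to second order. -/

/-! ### Hyperbolic inequalities. -/

theorem convexOn_sinh_Ici : ConvexOn ℝ (Set.Ici 0) Real.sinh := by
  refine MonotoneOn.convexOn_of_deriv (convex_Ici 0) Real.continuous_sinh.continuousOn
    Real.differentiable_sinh.differentiableOn ?_
  rw [Real.deriv_sinh]
  exact Real.cosh_strictMonoOn.monotoneOn.mono interior_subset

/-- Chords of the convex function `sinh` from the origin have increasing slope. -/
theorem mul_sinh_le_mul_sinh {s t : ℝ} (hs : 0 ≤ s) (hst : s ≤ t) :
    t * Real.sinh s ≤ s * Real.sinh t := by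
  rcases (hs.trans hst).eq_or_lt with rfl | ht
  · simp [le_antisymm hst hs]
  · have h := convexOn_sinh_Ici.2 (Set.mem_Ici.2 ht.le) (Set.mem_Ici.2 le_rfl)
      (show 0 ≤ s / t by positivity)
      (show 0 ≤ 1 - s / t by rw [sub_nonneg, div_le_one ht]; exact hst) (by ring)
    simp only [smul_eq_mul, mul_zero, add_zero, Real.sinh_zero] at h
    rw [div_mul_cancel₀ _ ht.ne', div_mul_eq_mul_div, le_div_iff₀ ht] at h
    linarith

/-- `tanh T / T`, extended continuously by `1` at `0`. -/
noncomputable def tanhc (T : ℝ) : ℝ := if T = 0 then 1 else Real.tanh T / T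

theorem tanhc_mul_self (T : ℝ) : tanhc T * T = Real.tanh T := by
  unfold tanhc
  split_ifs with h
  · simp [h]
  · field_simp

theorem tanhc_mul_cosh_mul_self (T : ℝ) : tanhc T * Real.cosh T * T = Real.sinh T := by
  rw [mul_right_comm, tanhc_mul_self, Real.tanh_eq_sinh_div_cosh,
    div_mul_cancel₀ _ (Real.cosh_pos T).ne']

theorem tanhc_pos {T : ℝ} (hT : 0 ≤ T) : 0 < tanhc T := by
  unfold tanhc
  split_ifs with h
  · exact one_pos
  · have hT' : 0 < T := lt_of_le_of_ne hT (Ne.symm h)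
    rw [Real.tanh_eq_sinh_div_cosh]
    exact div_pos (div_pos (Real.sinh_pos_iff.2 hT') (Real.cosh_pos T)) hT'

theorem sinh_le_mul_cosh {t : ℝ} (ht : 0 ≤ t) : Real.sinh t ≤ t * Real.cosh t := by
  have hd (x : ℝ) : HasDerivAt (fun x => x * Real.cosh x - Real.sinh x) (x * Real.sinh x) x := by
    refine (((hasDerivAt_id x).mul (Real.hasDerivAt_cosh x)).sub
      (Real.hasDerivAt_sinh x)).congr_deriv ?_
    simp
  have hdiff : Differentiable ℝ (fun x => x * Real.cosh x - Real.sinh x) :=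
    fun x => (hd x).differentiableAt
  have h := monotoneOn_of_deriv_nonneg (convex_Ici 0) hdiff.continuous.continuousOn
    hdiff.differentiableOn (fun x hx => by
      rw [interior_Ici] at hx
      rw [(hd x).deriv]
      exact mul_nonneg hx.le (Real.sinh_pos_iff.2 hx).le) (Set.mem_Ici.2 le_rfl) ht ht
  simpa using h

theorem tanhc_anti {s t : ℝ} (hs : 0 ≤ s) (hst : s ≤ t) : tanhc t ≤ tanhc s := by
  have hct := Real.cosh_pos t
  have hcs := Real.cosh_pos s
  rcases (hs.trans hst).eq_or_lt with rfl | ht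
  · rw [le_antisymm hst hs]
  -- This is the chord inequality at `t - s ≤ t + s`, expanded by the addition formulas.
  have key : s * (Real.sinh t * Real.cosh s) ≤ t * (Real.sinh s * Real.cosh t) := by
    have h := mul_sinh_le_mul_sinh (sub_nonneg.2 hst) (by linarith : t - s ≤ t + s)
    rw [Real.sinh_add, Real.sinh_sub] at h
    linarith
  rcases hs.eq_or_lt with rfl | hs
  · simp only [tanhc, if_neg ht.ne', if_true, Real.tanh_eq_sinh_div_cosh]
    rw [div_div, div_le_one (by positivity), mul_comm]
    exact sinh_le_mul_cosh ht.le
  · simp only [tanhc, if_neg ht.ne', if_neg hs.ne', Real.tanh_eq_sinh_div_cosh]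
    rw [div_div, div_div, div_le_div_iff₀ (by positivity) (by positivity)]
    linarith

/-- The line of slope `tanhc T * cosh T` is the chord of `sinh` from `0` to `T` (the tangent if `T =
0`), so convexity gives both signs. -/
theorem two_point_deriv_sign {T t : ℝ} (hT : 0 ≤ T) (ht : 0 ≤ t) :
    (t ≤ T → Real.sinh t ≤ tanhc T * Real.cosh T * t) ∧
      (T ≤ t → tanhc T * Real.cosh T * t ≤ Real.sinh t) := by
  have hk := tanhc_mul_cosh_mul_self T
  rcases hT.eq_or_lt with rfl | hT
  · simp only [tanhc, if_true, Real.cosh_zero, one_mul]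
    exact ⟨fun h => by simp [le_antisymm h ht], fun _ => Real.self_le_sinh_iff.2 ht⟩
  · constructor <;> intro h <;> rw [← mul_le_mul_iff_right₀ hT]
    · have := mul_sinh_le_mul_sinh ht h
      rw [← hk] at this
      linarith
    · have := mul_sinh_le_mul_sinh hT.le h
      rw [← hk] at this
      linarith

/-! ### The two-point inequality. -/

/-- The deficit in the logarithmic Sobolev inequality on the two-point space, in hyperbolic
coordinates: `T` describes the weights of the two points and `t` the function. -/
noncomputable def twoPointDeficit (T t : ℝ) : ℝ :=
  1 - 1 / (Real.cosh T * Real.cosh t) - tanhc T *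
    (t * Real.tanh t - Real.log (Real.cosh t) + Real.log (Real.cosh T))

theorem hasDerivAt_twoPointDeficit (T t : ℝ) :
    HasDerivAt (twoPointDeficit T)
      ((Real.sinh t - tanhc T * Real.cosh T * t) / (Real.cosh T * Real.cosh t ^ 2)) t := by
  have hct := (Real.cosh_pos t).ne'
  have hcT := (Real.cosh_pos T).ne'
  have e : twoPointDeficit T = fun t => 1 - (Real.cosh T * Real.cosh t)⁻¹ - tanhc T *
      (t * (Real.sinh t / Real.cosh t) - Real.log (Real.cosh t) + Real.log (Real.cosh T)) := by
    funext t
    simp only [twoPointDeficit, Real.tanh_eq_sinh_div_cosh, one_div]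
  rw [e]
  have hs := Real.hasDerivAt_sinh t
  have hc := Real.hasDerivAt_cosh t
  have h1 := ((hc.const_mul (Real.cosh T)).inv (mul_ne_zero hcT hct)).const_sub 1
  have h2 := ((((hasDerivAt_id t).mul (hs.div hc hct)).sub (hc.log hct)).add_const
    (Real.log (Real.cosh T))).const_mul (tanhc T)
  refine (h1.sub h2).congr_deriv ?_
  simp only [id, Pi.div_apply]
  field_simp
  linear_combination (-(Real.cosh T * tanhc T * t)) * Real.cosh_sq t

theorem twoPointDeficit_self (T : ℝ) : twoPointDeficit T T = 0 := by
  have hc := (Real.cosh_pos T).ne'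
  have h : tanhc T * (T * Real.tanh T - Real.log (Real.cosh T) + Real.log (Real.cosh T))
      = Real.tanh T ^ 2 := by
    rw [← tanhc_mul_self]
    ring
  rw [twoPointDeficit, h, Real.tanh_eq_sinh_div_cosh]
  field_simp
  linarith [Real.cosh_sq T]

theorem twoPointDeficit_nonneg_of_nonneg {T t : ℝ} (hT : 0 ≤ T) (ht : 0 ≤ t) :
    0 ≤ twoPointDeficit T t := by
  have hd : Differentiable ℝ (twoPointDeficit T) :=
    fun t => (hasDerivAt_twoPointDeficit T t).differentiableAt
  rw [← twoPointDeficit_self T]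
  have hpos (x : ℝ) : 0 < Real.cosh T * Real.cosh x ^ 2 := by
    have := Real.cosh_pos T
    have := Real.cosh_pos x
    positivity
  rcases le_total t T with h | h
  · refine antitoneOn_of_deriv_nonpos (convex_Icc 0 T) hd.continuous.continuousOn
      hd.differentiableOn ?_ ⟨ht, h⟩ ⟨hT, le_rfl⟩ h
    intro x hx
    rw [interior_Icc] at hx
    rw [(hasDerivAt_twoPointDeficit T x).deriv]
    exact div_nonpos_of_nonpos_of_nonneg
      (sub_nonpos.2 ((two_point_deriv_sign hT hx.1.le).1 hx.2.le)) (hpos x).le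
  · refine monotoneOn_of_deriv_nonneg (convex_Ici T) hd.continuous.continuousOn
      hd.differentiableOn ?_ (Set.mem_Ici.2 le_rfl) h h
    intro x hx
    rw [interior_Ici] at hx
    rw [(hasDerivAt_twoPointDeficit T x).deriv]
    exact div_nonneg
      (sub_nonneg.2 ((two_point_deriv_sign hT (hT.trans hx.le)).2 hx.le)) (hpos x).le

theorem twoPointDeficit_nonneg {T : ℝ} (hT : 0 ≤ T) (t : ℝ) : 0 ≤ twoPointDeficit T t := by
  rcases le_total 0 t with ht | ht
  · exact twoPointDeficit_nonneg_of_nonneg hT ht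
  · have := twoPointDeficit_nonneg_of_nonneg hT (neg_nonneg.2 ht)
    simpa [twoPointDeficit] using this

/-- The logarithmic Sobolev inequality on a two-point space with weights `1 : m`. -/
theorem two_point_logSobolev {m A b : ℝ} (hm : 1 ≤ m) (hA : 0 < A) (hb : 0 < b) :
    tanhc (Real.log m / 2) / 2 * (A ^ 2 * Real.log (A ^ 2) + m * b ^ 2 * Real.log (b ^ 2)
        - (A ^ 2 + m * b ^ 2) * Real.log ((A ^ 2 + m * b ^ 2) / (m + 1)))
      ≤ A ^ 2 + m * b ^ 2 - (A + m * b) ^ 2 / (m + 1) := by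
  obtain ⟨T, hT⟩ : ∃ T, T = Real.log m / 2 := ⟨_, rfl⟩
  -- Chosen so that `A ^ 2 : m * b ^ 2 = exp (-t) : exp t`; constants `A = b` correspond to `t = T`.
  obtain ⟨t, ht⟩ : ∃ t, t = T + Real.log b - Real.log A := ⟨_, rfl⟩
  have hT0 : 0 ≤ T := by
    rw [hT]
    have := Real.log_nonneg hm
    positivity
  have hme : m = Real.exp T * Real.exp T := by
    rw [← Real.exp_add, hT, add_halves, Real.exp_log (by linarith)]
  have hAl : Real.log b = Real.log A + t - T := by linarith
  have hbe : b = A * Real.exp t / Real.exp T := by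
    rw [← Real.exp_log hb, hAl, Real.exp_sub, Real.exp_add, Real.exp_log hA]
  have hcT := Real.cosh_pos T
  have hct := Real.cosh_pos t
  have eT := Real.exp_pos T
  have et := Real.exp_pos t
  have hm1 : m + 1 = 2 * Real.exp T * Real.cosh T := by
    rw [hme, Real.cosh_eq, Real.exp_neg]
    field_simp
  have hM : A ^ 2 + m * b ^ 2 = A ^ 2 * Real.exp t * (2 * Real.cosh t) := by
    rw [hme, hbe, Real.cosh_eq, Real.exp_neg]
    field_simp
    ring
  have hS : (A + m * b) ^ 2 / (m + 1) = A ^ 2 * Real.exp t *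
      ((1 + Real.cosh t * Real.cosh T + Real.sinh t * Real.sinh T) / Real.cosh T) := by
    rw [hm1, div_eq_iff (by positivity), hme, hbe]
    have h1 : A ^ 2 * Real.exp t *
        ((1 + Real.cosh t * Real.cosh T + Real.sinh t * Real.sinh T) / Real.cosh T) *
        (2 * Real.exp T * Real.cosh T) = A ^ 2 * Real.exp t *
        (1 + Real.cosh t * Real.cosh T + Real.sinh t * Real.sinh T) * (2 * Real.exp T) := by
      field_simp
    rw [h1]
    simp only [Real.cosh_eq, Real.sinh_eq, Real.exp_neg]
    field_simp
    ring
  have hL : Real.log ((A ^ 2 + m * b ^ 2) / (m + 1)) = 2 * Real.log A + t - T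
      + Real.log (Real.cosh t) - Real.log (Real.cosh T) := by
    rw [hM, hm1, Real.log_div (by positivity) (by positivity), Real.log_mul (by positivity)
      (by positivity), Real.log_mul (by positivity) (by positivity), Real.log_mul (by positivity)
      (by positivity), Real.log_mul (by positivity) (by positivity), Real.log_mul (by positivity)
      (by positivity), Real.log_exp, Real.log_exp, Real.log_pow]
    push_cast
    ring
  have hb2 : m * b ^ 2 = A ^ 2 * Real.exp t * Real.exp t := by
    rw [hme, hbe]
    field_simp
  have hA2 : A ^ 2 = A ^ 2 * Real.exp t * (Real.cosh t - Real.sinh t) := by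
    rw [Real.cosh_sub_sinh, mul_assoc, ← Real.exp_add]
    simp
  have hH : A ^ 2 * Real.log (A ^ 2) + m * b ^ 2 * Real.log (b ^ 2)
      - (A ^ 2 + m * b ^ 2) * Real.log ((A ^ 2 + m * b ^ 2) / (m + 1))
      = A ^ 2 * Real.exp t * (2 * Real.sinh t * (t - T)
        - 2 * Real.cosh t * (Real.log (Real.cosh t) - Real.log (Real.cosh T))) := by
    rw [hL, hM, hb2, Real.log_pow, Real.log_pow, hAl]
    nth_rewrite 1 [hA2]
    nth_rewrite 3 [← Real.cosh_add_sinh t]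
    push_cast
    ring
  have hdef := mul_nonneg (mul_nonneg (mul_nonneg (sq_nonneg A) et.le) hct.le)
    (twoPointDeficit_nonneg hT0 t)
  rw [hH, hS, hM, ← hT, ← sub_nonneg]
  refine hdef.trans_eq ?_
  have hk := tanhc_mul_cosh_mul_self T
  rw [twoPointDeficit, Real.tanh_eq_sinh_div_cosh, ← hk]
  field_simp
  ring

/-! ### The uniform measure on finitely many points. -/

/-- `#s` times the variance of `x` for the uniform measure on `s`. -/
noncomputable def lsVar {ι : Type*} (s : Finset ι) (x : ι → ℝ) : ℝ :=
  ∑ i ∈ s, x i ^ 2 - (∑ i ∈ s, x i) ^ 2 / s.card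

/-- `#s` times the entropy of `x ^ 2` for the uniform measure on `s`. -/
noncomputable def lsEnt {ι : Type*} (s : Finset ι) (x : ι → ℝ) : ℝ :=
  ∑ i ∈ s, x i ^ 2 * Real.log (x i ^ 2)
    - (∑ i ∈ s, x i ^ 2) * Real.log ((∑ i ∈ s, x i ^ 2) / s.card)

theorem lsVar_nonneg {ι : Type*} (s : Finset ι) (x : ι → ℝ) : 0 ≤ lsVar s x := by
  rcases s.eq_empty_or_nonempty with rfl | hs
  · simp [lsVar]
  · have hc : (0 : ℝ) < s.card := by exact_mod_cast hs.card_pos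
    rw [lsVar, sub_nonneg, div_le_iff₀ hc, mul_comm]
    exact sq_sum_le_card_mul_sum_sq

/-- The sharp logarithmic Sobolev inequality for the uniform measure on `n + 1` points. -/
theorem uniform_logSobolev {ι : Type*} [DecidableEq ι] (n : ℕ) (s : Finset ι) (x : ι → ℝ)
    (hs : s.card = n + 1) (hx : ∀ i ∈ s, 0 < x i) :
    tanhc (Real.log n / 2) / 2 * lsEnt s x ≤ lsVar s x := by
  induction n generalizing s with
  | zero =>
    obtain ⟨a, rfl⟩ := Finset.card_eq_one.1 hs
    simp [lsEnt, lsVar]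
  | succ n ih =>
    obtain ⟨a, ha, hmax⟩ := s.exists_max_image x (Finset.card_pos.1 (by omega))
    have hcard : (s.erase a).card = n + 1 := by rw [Finset.card_erase_of_mem ha]; omega
    have hxt : ∀ i ∈ s.erase a, 0 < x i := fun i hi => hx i (Finset.mem_of_mem_erase hi)
    have hle : ∀ i ∈ s.erase a, x i ≤ x a := fun i hi => hmax i (Finset.mem_of_mem_erase hi)
    have hne : (s.erase a).Nonempty := Finset.card_pos.1 (by omega)
    have hA := hx a ha
    have IH := ih (s.erase a) hcard hxt
    have hV := lsVar_nonneg (s.erase a) x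
    have hsum (f : ι → ℝ) : ∑ i ∈ s, f i = f a + ∑ i ∈ s.erase a, f i :=
      (Finset.add_sum_erase s f ha).symm
    have hm1 : (1 : ℝ) ≤ ((n + 1 : ℕ) : ℝ) := by exact_mod_cast Nat.le_add_left 1 n
    obtain ⟨m, hm⟩ : ∃ m : ℝ, m = ((n + 1 : ℕ) : ℝ) := ⟨_, rfl⟩
    have hscard : ((s.card : ℕ) : ℝ) = m + 1 := by rw [hs, hm]; push_cast; ring
    have hQ : 0 < ∑ i ∈ s.erase a, x i ^ 2 := Finset.sum_pos (fun i hi => pow_pos (hxt i hi) 2) hne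
    have hS : 0 < ∑ i ∈ s.erase a, x i := Finset.sum_pos hxt hne
    have hSA : ∑ i ∈ s.erase a, x i ≤ m * x a := by
      have := Finset.sum_le_card_nsmul _ _ _ hle
      rwa [hcard, nsmul_eq_mul, ← hm] at this
    have hQA : ∑ i ∈ s.erase a, x i ^ 2 ≤ m * x a ^ 2 := by
      have := Finset.sum_le_card_nsmul _ (fun i => x i ^ 2) (x a ^ 2)
        (fun i hi => pow_le_pow_left₀ (hxt i hi).le (hle i hi) 2)
      rwa [hcard, nsmul_eq_mul, ← hm] at this
    rw [← hm] at hm1 ⊢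
    have hanti : tanhc (Real.log m / 2) ≤ tanhc (Real.log n / 2) := by
      refine tanhc_anti (by have := Real.log_natCast_nonneg n; positivity) ?_
      -- For `n = 0` the convention `Real.log 0 = 0` makes the earlier constant `tanhc 0`, the
      -- largest one.
      rcases Nat.eq_zero_or_pos n with rfl | hn
      · have := Real.log_nonneg hm1
        simpa using div_nonneg this zero_le_two
      · have := Real.log_le_log (by exact_mod_cast hn : (0 : ℝ) < n)
          (by rw [hm]; push_cast; linarith : (n : ℝ) ≤ m)
        linarith
    have hkpos : 0 < tanhc (Real.log m / 2) := tanhc_pos (by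
      have := Real.log_nonneg hm1
      positivity)
    have IH' : tanhc (Real.log m / 2) / 2 * lsEnt (s.erase a) x ≤ lsVar (s.erase a) x := by
      rcases le_total 0 (lsEnt (s.erase a) x) with h | h
      · exact (mul_le_mul_of_nonneg_right (by linarith) h).trans IH
      · exact (mul_nonpos_of_nonneg_of_nonpos (by positivity) h).trans hV
    clear IH ih
    simp only [lsVar, lsEnt, hsum, hscard, hcard, ← hm] at IH' hV ⊢
    generalize ∑ i ∈ s.erase a, x i ^ 2 * Real.log (x i ^ 2) = E at *
    generalize ∑ i ∈ s.erase a, x i ^ 2 = Q at *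
    generalize ∑ i ∈ s.erase a, x i = S at *
    generalize x a = A at *
    have hm0 : 0 < m := by linarith
    -- With the root mean square, total entropy is exactly the entropy of the remaining points plus
    -- the two-point entropy.
    obtain ⟨b, hb⟩ : ∃ b, b = √(Q / m) := ⟨_, rfl⟩
    have hb0 : 0 < b := by rw [hb]; positivity
    have hb2 : b ^ 2 = Q / m := by rw [hb, Real.sq_sqrt (by positivity)]
    have hQb : Q = m * b ^ 2 := by rw [hb2]; field_simp
    have two := two_point_logSobolev hm1 hA hb0
    subst hQb
    have hbA : b ≤ A := le_of_sq_le_sq (le_of_mul_le_mul_left hQA hm0) hA.le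
    have hSb : S ≤ m * b := by
      refine le_of_sq_le_sq ?_ (by positivity)
      rw [sub_nonneg, div_le_iff₀ hm0] at hV
      linarith
    have e1 : m * b ^ 2 / m = b ^ 2 := by field_simp
    rw [e1] at IH'
    -- The variance of the remaining points is covered by what the two-point variance loses when `S`
    -- is replaced by `m * b`; after factoring out `m * b - S` this is `b + S / m ≤ 2 * A`, where
    -- maximality of `A` enters.
    have key : m * b ^ 2 - S ^ 2 / m ≤ (A + m * b) ^ 2 / (m + 1) - (A + S) ^ 2 / (m + 1) := by
      have h1 : m * b ^ 2 - S ^ 2 / m = (m * b - S) * (b + S / m) := by field_simp; ring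
      have h2 : S / m ≤ A := by rw [div_le_iff₀ hm0]; linarith
      have h3 : m * (S / m) = S := by field_simp
      rw [h1, ← sub_div, le_div_iff₀ (by linarith)]
      have h4 : (m + 1) * (b + S / m) ≤ 2 * A + m * b + S := by nlinarith
      nlinarith [mul_le_mul_of_nonneg_left h4 (sub_nonneg.2 hSb)]
    linarith

/-! ### Reduction of entropy and Dirichlet form to eigenvalues. -/

open Matrix in
theorem trace_cfc_eq_sum {n : Type*} [Fintype n] [DecidableEq n] {A : Matrix n n ℂ}
    (hA : A.IsHermitian) (g : ℝ → ℝ) : (cfc g A).trace = ∑ i, (g (hA.eigenvalues i) : ℂ) := by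
  rw [hA.cfc_eq, IsHermitian.cfc, Unitary.conjStarAlgAut_apply, trace_mul_comm, ← mul_assoc]
  simp [trace_diagonal]

theorem cfc_congr_of_posDef {n : Type*} [Fintype n] [DecidableEq n] {A : Matrix n n ℂ}
    (hA : A.PosDef) {g h : ℝ → ℝ} (hgh : ∀ x, 0 < x → g x = h x) : cfc g A = cfc h A := by
  refine cfc_congr fun x hx => hgh x ?_
  rw [hA.1.spectrum_real_eq_range_eigenvalues] at hx
  obtain ⟨i, rfl⟩ := hx
  exact hA.eigenvalues_pos i

theorem continuousOn_matrix_spectrum {n : Type*} [Fintype n] [DecidableEq n] (A : Matrix n n ℂ)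
    (g : ℝ → ℝ) : ContinuousOn g (spectrum ℝ A) :=
  (Matrix.finite_real_spectrum (A := A)).continuousOn g

theorem cfc_matrix_smul {n : Type*} [Fintype n] [DecidableEq n] {A : Matrix n n ℂ}
    (hA : A.IsHermitian) (c : ℝ) (g : ℝ → ℝ) : cfc g (c • A) = cfc (fun x => g (c * x)) A :=
  (cfc_comp_const_mul c g A (((Matrix.finite_real_spectrum (A := A)).image _).continuousOn g)
    hA).symm

/-- The maximally mixed state `1 / d`. -/
noncomputable def maxMixed (d : ℕ) : Md d := algebraMap ℝ (Md d) (1 / d)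

theorem gam_maxMixed {d : ℕ} (hd : 0 < d) (s : ℝ) (f : Md d) :
    Gam (maxMixed d) s f = ((1 / d : ℝ) ^ s) • f := by
  have hr : (0 : ℝ) < 1 / d := by positivity
  rw [Gam, maxMixed, cfc_algebraMap, Algebra.algebraMap_eq_smul_one, smul_mul_assoc, one_mul,
    smul_mul_smul_comm, mul_one, ← Real.rpow_add hr, add_halves]

theorem lpInner_maxMixed {d : ℕ} (hd : 0 < d) (f g : Md d) :
    lpInner (maxMixed d) f g = (1 / d : ℝ) * (f * g).trace.re := by
  rw [lpInner, gam_maxMixed hd, Real.rpow_one, smul_mul_assoc, Matrix.trace_smul,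
    Complex.smul_re, smul_eq_mul]

theorem powerOp_two_maxMixed {d : ℕ} (hd : 0 < d) {f : Md d} (hf : f.PosDef) :
    powerOp (maxMixed d) 2 2 f = f := by
  have hr : (0 : ℝ) < 1 / d := by positivity
  have hc : (0 : ℝ) < (1 / d : ℝ) ^ (1 / 2 : ℝ) := by positivity
  rw [powerOp, gam_maxMixed hd, gam_maxMixed hd, cfc_matrix_smul hf.1,
    cfc_congr_of_posDef hf (h := fun x => (1 / d : ℝ) ^ (1 / 2 : ℝ) * x), cfc_const_mul_id _ _ hf.1.isSelfAdjoint,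
    smul_smul, ← Real.rpow_add hr]
  · simp
  · intro x hx
    rw [div_self two_ne_zero, Real.rpow_one, abs_of_pos (mul_pos hc hx)]

/-- The scalar that `Gam` puts inside the logarithm contributes half of `log (1 / d)`, which the
`log σ` term cancels. -/
theorem opEnt_two_maxMixed {d : ℕ} (hd : 0 < d) {f : Md d} (hf : f.PosDef) :
    opEnt (maxMixed d) 2 f = f * cfc Real.log f := by
  have hr : (0 : ℝ) < 1 / d := by positivity
  have hc : (0 : ℝ) < (1 / d : ℝ) ^ (1 / 2 : ℝ) := by positivity
  have hlog : cfc (fun x => Real.log ((1 / d : ℝ) ^ (1 / 2 : ℝ) * x)) f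
      = (1 / 2 * Real.log (1 / d)) • (1 : Md d) + cfc Real.log f := by
    rw [cfc_congr_of_posDef hf (h := fun x => 1 / 2 * Real.log (1 / d) + Real.log x),
      cfc_const_add _ _ _ (continuousOn_matrix_spectrum _ _) hf.1.isSelfAdjoint, Algebra.algebraMap_eq_smul_one]
    intro x hx
    rw [Real.log_mul hc.ne' hx.ne', Real.log_rpow hr]
  rw [opEnt, gam_maxMixed hd, gam_maxMixed hd, cfc_matrix_smul hf.1, hlog, smul_mul_assoc,
    smul_smul, ← Real.rpow_add hr, neg_add_cancel, Real.rpow_zero, one_smul, maxMixed,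
    cfc_algebraMap, Algebra.algebraMap_eq_smul_one]
  simp only [mul_add, mul_smul_comm, smul_mul_assoc, mul_one, one_mul]
  module

theorem Ent_two_maxMixed {d : ℕ} (hd : 0 < d) {f : Md d} (hf : f.PosDef) :
    Ent (maxMixed d) 2 f = 1 / (2 * d) * lsEnt Finset.univ hf.1.eigenvalues := by
  have hd' : (0 : ℝ) < d := by exact_mod_cast hd
  have hr : (0 : ℝ) < 1 / d := by positivity
  have hfl : f * (f * cfc Real.log f) = cfc (fun x => x * (x * Real.log x)) f := by
    rw [cfc_mul _ _ _ (continuousOn_matrix_spectrum _ _) (continuousOn_matrix_spectrum _ _),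
      cfc_mul _ _ _ (continuousOn_matrix_spectrum _ _) (continuousOn_matrix_spectrum _ _),
      cfc_id' ℝ f hf.1.isSelfAdjoint]
  have hQ : 0 ≤ ∑ i, hf.1.eigenvalues i ^ 2 := Finset.sum_nonneg fun i _ => sq_nonneg _
  have hnorm : lpNorm (maxMixed d) 2 f
      = ((∑ i, hf.1.eigenvalues i ^ 2) / d) ^ (1 / 2 : ℝ) := by
    rw [lpNorm, gam_maxMixed hd, cfc_matrix_smul hf.1, trace_cfc_eq_sum hf.1,
      ← Complex.ofReal_sum, Complex.ofReal_re, Finset.sum_div]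
    congr 1
    refine Finset.sum_congr rfl fun i _ => ?_
    rw [Real.rpow_two, sq_abs, mul_pow, ← Real.rpow_two ((1 / d : ℝ) ^ _), ← Real.rpow_mul hr.le]
    norm_num
    ring
  have h2 : (2 : ℝ) / (2 - 1) = 2 := by norm_num
  rw [Ent, h2, powerOp_two_maxMixed hd hf, opEnt_two_maxMixed hd hf, lpInner_maxMixed hd, hfl,
    trace_cfc_eq_sum hf.1, ← Complex.ofReal_sum, Complex.ofReal_re, hnorm, ← Real.rpow_mul
    (by positivity), lsEnt, Finset.card_univ, Fintype.card_fin]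
  have hlog : Real.log (((∑ i, hf.1.eigenvalues i ^ 2) / d) ^ (1 / 2 : ℝ))
      = 1 / 2 * Real.log ((∑ i, hf.1.eigenvalues i ^ 2) / d) := by
    rcases (div_nonneg hQ hd'.le).eq_or_lt with h | h
    · rw [← h, Real.zero_rpow (by norm_num)]
      simp
    · rw [Real.log_rpow h]
  have hsum : ∑ i, hf.1.eigenvalues i ^ 2 * Real.log (hf.1.eigenvalues i ^ 2)
      = 2 * ∑ i, hf.1.eigenvalues i * (hf.1.eigenvalues i * Real.log (hf.1.eigenvalues i)) := by
    rw [Finset.mul_sum]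
    refine Finset.sum_congr rfl fun i _ => ?_
    rw [Real.log_pow]
    push_cast
    ring
  rw [hlog, hsum, one_div_mul_cancel two_ne_zero, Real.rpow_one]
  field_simp

theorem dirichletForm_depolarizing {d : ℕ} (hd : 0 < d) (γ : ℝ) {f : Md d} (hf : f.PosDef) :
    dirichletForm (depolarizing d γ) (maxMixed d) 2 f
      = γ / d * lsVar Finset.univ hf.1.eigenvalues := by
  have hff : f * f = cfc (fun x : ℝ => x ^ 2) f := by
    rw [cfc_pow_id (R := ℝ) f 2 hf.1.isSelfAdjoint, sq]
  have h2 : (2 : ℝ) / (2 - 1) = 2 := by norm_num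
  have htr : (f * depolarizing d γ f).trace.re
      = γ * ((∑ i, hf.1.eigenvalues i) ^ 2 / d - ∑ i, hf.1.eigenvalues i ^ 2) := by
    have : (f * depolarizing d γ f).trace
        = (γ : ℂ) * (f.trace ^ 2 / d - (f * f).trace) := by
      simp only [depolarizing, LinearMap.coe_mk, AddHom.coe_mk, mul_smul_comm, mul_sub, mul_one,
        Matrix.trace_smul, Matrix.trace_sub, smul_eq_mul]
      ring
    rw [this, hff, trace_cfc_eq_sum hf.1, hf.1.trace_eq_sum_eigenvalues]
    have e : (γ : ℂ) * ((∑ i, (hf.1.eigenvalues i : ℂ)) ^ 2 / d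
        - ∑ i, ((hf.1.eigenvalues i ^ 2 : ℝ) : ℂ))
        = ((γ * ((∑ i, hf.1.eigenvalues i) ^ 2 / d - ∑ i, hf.1.eigenvalues i ^ 2) : ℝ) : ℂ) := by
      push_cast
      ring
    exact (congrArg Complex.re e).trans (Complex.ofReal_re _)
  rw [dirichletForm, h2, powerOp_two_maxMixed hd hf, lpInner_maxMixed hd, htr, lsVar,
    Finset.card_univ, Fintype.card_fin]
  ring

/-! ### The depolarizing generator: stationary state and Lindblad form. -/

theorem isPrimitiveAt_depolarizing {d : ℕ} (hd : 0 < d) {γ : ℝ} (hγ : 0 < γ) :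
    IsPrimitiveAt (depolarizing d γ) (maxMixed d) := by
  have hdC : (d : ℂ) ≠ 0 := by exact_mod_cast hd.ne'
  have hr : (0 : ℝ) < 1 / d := by positivity
  have hpd : (maxMixed d).PosDef := by
    rw [maxMixed, Algebra.algebraMap_eq_smul_one]
    exact Matrix.PosDef.one.smul hr
  have hsm : maxMixed d = (1 / d : ℂ) • (1 : Md d) := by
    rw [maxMixed, Algebra.algebraMap_eq_smul_one]
    ext i j
    simp [Complex.real_smul]
  have htr : (maxMixed d).trace = 1 := by
    rw [hsm]
    simp [hdC]
  refine ⟨⟨hpd.posSemidef, htr⟩, hpd, fun f => ?_, fun ρ hρ hst => ?_⟩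
  · rw [hsm]
    simp [depolarizing, hdC]
  · rw [Matrix.ext_iff_trace_mul_right]
    intro f
    have h := hst f
    simp only [depolarizing, LinearMap.coe_mk, AddHom.coe_mk, mul_smul_comm, mul_sub, mul_one,
      Matrix.trace_smul, Matrix.trace_sub, smul_eq_mul, hρ.2] at h
    have hγC : (γ : ℂ) ≠ 0 := Complex.ofReal_ne_zero.2 hγ.ne'
    rw [← mul_sub, mul_eq_zero, or_iff_right hγC] at h
    rw [hsm, smul_mul_assoc, one_mul, Matrix.trace_smul, smul_eq_mul]
    linear_combination -h

theorem isLiouvillian_depolarizing {d : ℕ} (hd : 0 < d) {γ : ℝ} (hγ : 0 < γ) :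
    IsLiouvillian (depolarizing d γ) := by
  have hdC : (d : ℂ) ≠ 0 := by exact_mod_cast hd.ne'
  obtain ⟨c, hc⟩ : ∃ c : ℂ, star c * c = γ / d := by
    refine ⟨(√(γ / d) : ℝ), ?_⟩
    rw [Complex.star_def, Complex.conj_ofReal, ← Complex.ofReal_mul,
      Real.mul_self_sqrt (by positivity)]
    push_cast
    rfl
  -- The jump operators are all matrix units scaled by `c`, with `|c| ^ 2 = γ / d`.
  refine ⟨0, d * d, fun k => Matrix.single (finProdFinEquiv.symm k).1 (finProdFinEquiv.symm k).2 c,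
    Matrix.isHermitian_zero, fun f => ?_⟩
  rw [← finProdFinEquiv.sum_comp]
  simp only [Equiv.symm_apply_apply, Fintype.sum_prod_type, Matrix.conjTranspose_single,
    Matrix.single_mul_mul_single, Matrix.single_mul_single_same, zero_mul, mul_zero, sub_self,
    smul_zero, zero_add]
  have hsum (z : ℂ) : ∑ j : Fin d, Matrix.single j j z = z • (1 : Md d) := by
    ext a b
    simp [Matrix.sum_apply, Matrix.single_apply, Matrix.one_apply, ite_and]
  have htr : ∑ i, star c * f i i * c = γ / d * f.trace := by
    rw [Matrix.trace, Finset.mul_sum]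
    refine Finset.sum_congr rfl fun i _ => ?_
    rw [← hc, Matrix.diag_apply]
    ring
  simp only [Finset.sum_sub_distrib, ← Finset.smul_sum, Finset.sum_add_distrib, ← Finset.sum_mul,
    ← Finset.mul_sum, hsum, ← Finset.sum_smul, htr, hc, Finset.sum_const, Finset.card_univ,
    Fintype.card_fin, depolarizing, LinearMap.coe_mk, AddHom.coe_mk, smul_mul_assoc,
    mul_smul_comm, one_mul, mul_one, ← Nat.cast_smul_eq_nsmul ℂ]
  match_scalars <;> field_simp
  ring

/-! ### From diagonal matrices to the scalar inequality. -/

/-- Both multisets are the roots of the characteristic polynomial; the ordering may differ. -/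
theorem map_eigenvalues_diagonal {n : Type*} [Fintype n] [DecidableEq n] (x : n → ℝ)
    (hx : (Matrix.diagonal fun i => (x i : ℂ)).IsHermitian) :
    (Finset.univ.val.map hx.eigenvalues) = Finset.univ.val.map x := by
  have h := hx.roots_charpoly_eq_eigenvalues
  rw [Matrix.charpoly_diagonal, Polynomial.roots_prod _ _
    (Finset.prod_ne_zero_iff.2 fun i _ => Polynomial.X_sub_C_ne_zero _)] at h
  simp only [Polynomial.roots_X_sub_C, Multiset.bind_singleton] at h
  refine Multiset.map_injective Complex.ofReal_injective ?_
  rw [Multiset.map_map, Multiset.map_map]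
  exact h.symm

theorem sum_eigenvalues_diagonal {n : Type*} [Fintype n] [DecidableEq n] (x : n → ℝ)
    (hx : (Matrix.diagonal fun i => (x i : ℂ)).IsHermitian) (g : ℝ → ℝ) :
    ∑ i, g (hx.eigenvalues i) = ∑ i, g (x i) := by
  have h := congrArg (fun s => (Multiset.map g s).sum) (map_eigenvalues_diagonal x hx)
  simp only [Multiset.map_map] at h
  exact h

/-- An admissible constant satisfies the scalar logarithmic Sobolev inequality. -/
theorem lsEnt_le_lsVar_of_forall_posDef {d : ℕ} (hd : 0 < d) {γ a : ℝ}
    (h : ∀ f : Md d, f.PosDef →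
      a * Ent (maxMixed d) 2 f ≤ dirichletForm (depolarizing d γ) (maxMixed d) 2 f)
    (x : Fin d → ℝ) (hx : ∀ i, 0 < x i) :
    a / 2 * lsEnt Finset.univ x ≤ γ * lsVar Finset.univ x := by
  have hd' : (0 : ℝ) < d := by exact_mod_cast hd
  have hf : (Matrix.diagonal fun i => (x i : ℂ)).PosDef :=
    Matrix.PosDef.diagonal fun i => Complex.zero_lt_real.2 (hx i)
  have key := h _ hf
  rw [Ent_two_maxMixed hd hf, dirichletForm_depolarizing hd γ hf] at key
  have hE : lsEnt Finset.univ hf.1.eigenvalues = lsEnt Finset.univ x := by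
    simp only [lsEnt, sum_eigenvalues_diagonal x hf.1 (fun y => y ^ 2),
      sum_eigenvalues_diagonal x hf.1 (fun y => y ^ 2 * Real.log (y ^ 2))]
  have hV : lsVar Finset.univ hf.1.eigenvalues = lsVar Finset.univ x := by
    simp only [lsVar, sum_eigenvalues_diagonal x hf.1 (fun y => y ^ 2),
      sum_eigenvalues_diagonal x hf.1 (fun y => y)]
  rw [hE, hV] at key
  have := mul_le_mul_of_nonneg_right key hd'.le
  calc a / 2 * lsEnt Finset.univ x = a * (1 / (2 * d) * lsEnt Finset.univ x) * d := by field_simp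
    _ ≤ γ / d * lsVar Finset.univ x * d := this
    _ = γ * lsVar Finset.univ x := by field_simp

theorem isLSConstant_depolarizing {d : ℕ} (hd : 1 < d) {γ α : ℝ} (hγ : 0 < γ)
    (hα : α = γ * tanhc (Real.log ((d : ℝ) - 1) / 2))
    (hmax : ∀ a : ℝ, (∀ x : Fin d → ℝ, (∀ i, 0 < x i) →
      a / 2 * lsEnt Finset.univ x ≤ γ * lsVar Finset.univ x) → a ≤ α) :
    IsLSConstant (depolarizing d γ) 2 α := by
  have hd0 : 0 < d := by omega
  have hd' : (0 : ℝ) < d := by exact_mod_cast hd0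
  have hd1 : (d : ℝ) - 1 = ((d - 1 : ℕ) : ℝ) := by rw [Nat.cast_sub hd.le, Nat.cast_one]
  refine ⟨isLiouvillian_depolarizing hd0 hγ, maxMixed d, isPrimitiveAt_depolarizing hd0 hγ,
    ⟨?_, fun f hf => ?_⟩, fun a ha => hmax a (lsEnt_le_lsVar_of_forall_posDef hd0 ha.2)⟩
  · rw [hα, hd1]
    have := Real.log_natCast_nonneg (d - 1)
    exact mul_pos hγ (tanhc_pos (by positivity))
  · rw [Ent_two_maxMixed hd0 hf, dirichletForm_depolarizing hd0 γ hf, hα, hd1]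
    have key := uniform_logSobolev (d - 1) Finset.univ hf.1.eigenvalues
      (by rw [Finset.card_univ, Fintype.card_fin]; omega) (fun i _ => hf.eigenvalues_pos i)
    calc _ = γ / d * (tanhc (Real.log (d - 1 : ℕ) / 2) / 2
          * lsEnt Finset.univ hf.1.eigenvalues) := by field_simp
      _ ≤ _ := mul_le_mul_of_nonneg_left key (by positivity)

theorem tanhc_log_half {y : ℝ} (hy : 1 < y) :
    tanhc (Real.log y / 2) = 2 * (1 - 2 / (y + 1)) / Real.log y := by
  have hl : 0 < Real.log y := Real.log_pos hy
  have hy0 : 0 < y := by linarith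
  have hs : Real.exp (Real.log y / 2) * Real.exp (Real.log y / 2) = y := by
    rw [← Real.exp_add, add_halves, Real.exp_log hy0]
  have he := Real.exp_pos (Real.log y / 2)
  have ht : Real.tanh (Real.log y / 2) = (y - 1) / (y + 1) := by
    rw [Real.tanh_eq_sinh_div_cosh, Real.sinh_eq, Real.cosh_eq, Real.exp_neg,
      div_eq_div_iff (by positivity) (by positivity)]
    generalize Real.exp (Real.log y / 2) = w at *
    subst hs
    field_simp
  rw [tanhc, if_neg (by positivity), ht]
  field_simp
  ring

/-! ### Sharpness of the constant. -/

theorem le_of_logSobolev_of_three_le {d : ℕ} (hd : 3 ≤ d) {γ a : ℝ}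
    (h : ∀ x : Fin d → ℝ, (∀ i, 0 < x i) →
      a / 2 * lsEnt Finset.univ x ≤ γ * lsVar Finset.univ x) :
    a ≤ 2 * γ * (1 - 2 / (d : ℝ)) / Real.log ((d : ℝ) - 1) := by
  obtain ⟨n, rfl⟩ : ∃ n, d = n + 1 := ⟨d - 1, by omega⟩
  have hn : (2 : ℝ) ≤ n := by exact_mod_cast (by omega : 2 ≤ n)
  -- The extremal vector: its mean square is `n`, so `lsEnt` equals `n * (n - 1) * log n`.
  have key := h (Fin.cons (n : ℝ) fun _ => 1) (Fin.cases (by simp; linarith) (by simp))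
  have hl : 0 < Real.log n := Real.log_pos (by linarith)
  have e1 : ((n : ℝ) ^ 2 + n) / (n + 1) = n := by field_simp
  simp only [lsEnt, lsVar, Fin.sum_univ_succ, Fin.cons_zero, Fin.cons_succ, Finset.sum_const,
    Finset.card_univ, Fintype.card_fin, one_pow, Real.log_one, smul_zero, nsmul_eq_mul, mul_one,
    mul_zero, add_zero, Nat.cast_add, Nat.cast_one, e1, Real.log_pow, Nat.cast_ofNat] at key
  have e2 : ((n + 1 : ℕ) : ℝ) - 1 = n := by push_cast; ring
  rw [e2, le_div_iff₀ hl]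
  push_cast
  have hp : (0 : ℝ) < n * (n - 1) := mul_pos (by linarith) (by linarith)
  have e3 : γ * ((n : ℝ) ^ 2 + n - (n + n) ^ 2 / (n + 1))
      = (2 * γ * (1 - 2 / (n + 1))) * (n * (n - 1) / 2) := by
    field_simp
    ring
  rw [e3] at key
  refine le_of_mul_le_mul_right ?_ (half_pos hp)
  linarith

theorem cosh_sub_one_le (t : ℝ) : Real.cosh t - 1 ≤ t ^ 2 / 2 * Real.exp (t ^ 2 / 2) := by
  have h1 := Real.cosh_le_exp_half_sq t
  have h2 := Real.add_one_le_exp (-(t ^ 2 / 2))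
  have h3 := mul_le_mul_of_nonneg_right h2 (Real.exp_pos (t ^ 2 / 2)).le
  rw [← Real.exp_add, neg_add_cancel, Real.exp_zero] at h3
  linarith

theorem le_of_logSobolev_two {γ a : ℝ} (hγ : 0 < γ)
    (h : ∀ x : Fin 2 → ℝ, (∀ i, 0 < x i) →
      a / 2 * lsEnt Finset.univ x ≤ γ * lsVar Finset.univ x) : a ≤ γ := by
  rcases le_total a 0 with ha | ha
  · linarith
  -- The test vector `(exp (-t/2), exp (t/2))` gives `a * (t sinh t - cosh t log cosh t) ≤ γ * (cosh
  -- t - 1)`; both sides are of order `t ^ 2`, which is divided out before `t → 0`.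
  have key : ∀ t : ℝ, 0 < t → a * (1 - Real.cosh t / 2) ≤ γ / 2 * Real.exp (t ^ 2 / 2) := by
    intro t ht
    have := h ![Real.exp (-(t / 2)), Real.exp (t / 2)] (by
      intro i
      fin_cases i <;> simp [Real.exp_pos])
    have e1 : Real.exp (-(t / 2)) ^ 2 = Real.exp (-t) := by
      rw [← Real.exp_nat_mul]
      congr 1
      push_cast
      ring
    have e2 : Real.exp (t / 2) ^ 2 = Real.exp t := by
      rw [← Real.exp_nat_mul]
      congr 1
      push_cast
      ring
    have e3 : Real.exp (-(t / 2)) * Real.exp (t / 2) = 1 := by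
      rw [← Real.exp_add, neg_add_cancel, Real.exp_zero]
    have e4 : (Real.exp (-t) + Real.exp t) = 2 * Real.cosh t := by
      rw [Real.cosh_eq]
      ring
    have e5 : (Real.exp (-(t / 2)) + Real.exp (t / 2)) ^ 2 = 2 * Real.cosh t + 2 := by
      rw [add_sq, e1, e2, mul_assoc, e3, ← e4]
      ring
    have e6 : Real.exp (-t) * -t + Real.exp t * t = 2 * Real.sinh t * t := by
      rw [Real.sinh_eq]
      ring
    simp only [lsEnt, lsVar, Fin.sum_univ_two, Matrix.cons_val_zero, Matrix.cons_val_one,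
      Finset.card_univ, Fintype.card_fin, e1, e2, e4, e5, e6, Real.log_exp, Nat.cast_ofNat,
      mul_div_cancel_left₀ _ (two_ne_zero' ℝ)] at this
    have hc := Real.one_le_cosh t
    have hlog : Real.log (Real.cosh t) ≤ t ^ 2 / 2 := by
      rw [Real.log_le_iff_le_exp (by linarith)]
      exact Real.cosh_le_exp_half_sq t
    have hs : t ≤ Real.sinh t := Real.self_le_sinh_iff.2 ht.le
    have h1 : t ^ 2 * (1 - Real.cosh t / 2)
        ≤ Real.sinh t * t - Real.cosh t * Real.log (Real.cosh t) := by
      nlinarith [mul_le_mul_of_nonneg_right hs ht.le,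
        mul_le_mul_of_nonneg_left hlog (zero_le_one.trans hc)]
    have h2 := mul_le_mul_of_nonneg_left h1 ha
    have h3 := mul_le_mul_of_nonneg_left (cosh_sub_one_le t) hγ.le
    refine le_of_mul_le_mul_left ?_ (pow_pos ht 2)
    linarith
  have hlim : Tendsto (fun t : ℝ => a * (1 - Real.cosh t / 2)) (𝓝[>] 0) (𝓝 (a / 2)) := by
    have : Continuous fun t : ℝ => a * (1 - Real.cosh t / 2) := by
      have := Real.continuous_cosh
      fun_prop
    refine (this.tendsto' 0 _ ?_).mono_left nhdsWithin_le_nhds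
    rw [Real.cosh_zero]
    ring
  have hlim' : Tendsto (fun t : ℝ => γ / 2 * Real.exp (t ^ 2 / 2)) (𝓝[>] 0) (𝓝 (γ / 2)) := by
    have : Continuous fun t : ℝ => γ / 2 * Real.exp (t ^ 2 / 2) := by fun_prop
    refine (this.tendsto' 0 _ ?_).mono_left nhdsWithin_le_nhds
    simp
  have := le_of_tendsto_of_tendsto hlim hlim'
    (eventually_nhdsWithin_of_forall fun t ht => key t ht)
  linarith

/-! ### The limit at dimension two and the conclusion. -/

theorem tendsto_logSobolev_constant (γ : ℝ) :
    Tendsto (fun x : ℝ => 2 * γ * (1 - 2 / x) / Real.log (x - 1)) (𝓝[≠] 2) (𝓝 γ) := by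
  have hd : HasDerivAt (fun x : ℝ => Real.log (x - 1)) 1 2 := by
    have := ((hasDerivAt_id (2 : ℝ)).sub_const 1).log (by norm_num)
    refine this.congr_deriv ?_
    norm_num
  -- The formula is `2 * γ / x` times the inverse slope of `log (x - 1)` at `2`.
  have h1 := (hasDerivAt_iff_tendsto_slope.1 hd).inv₀ one_ne_zero
  have h2 : Tendsto (fun x : ℝ => 2 * γ / x) (𝓝[≠] 2) (𝓝 γ) := by
    have : ContinuousAt (fun x : ℝ => 2 * γ / x) 2 :=
      continuousAt_const.div continuousAt_id two_ne_zero
    have h := this.tendsto.mono_left (nhdsWithin_le_nhds (s := {2}ᶜ))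
    rwa [mul_div_cancel_left₀ _ (two_ne_zero' ℝ)] at h
  have h3 := h2.mul h1
  rw [inv_one, mul_one] at h3
  refine h3.congr' ?_
  have hne : ∀ᶠ x : ℝ in 𝓝[≠] 2, x ≠ 0 :=
    mem_nhdsWithin_of_mem_nhds (isOpen_ne.mem_nhds (two_ne_zero' ℝ))
  filter_upwards [hne] with x hx
  have h0 : Real.log ((2 : ℝ) - 1) = 0 := by norm_num
  rw [slope_def_field, h0, sub_zero, inv_div]
  field_simp

theorem theorem5p1 (γ : ℝ) (hγ : 0 < γ) :
    (∀ d : ℕ, 3 ≤ d →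
      IsLSConstant (depolarizing d γ) 2 (2 * γ * (1 - 2 / (d : ℝ)) / Real.log ((d : ℝ) - 1))) ∧
    IsLSConstant (depolarizing 2 γ) 2 γ ∧
    Tendsto (fun x : ℝ => 2 * γ * (1 - 2 / x) / Real.log (x - 1)) (𝓝[≠] 2) (𝓝 γ) := by
  refine ⟨fun d hd => ?_, ?_, tendsto_logSobolev_constant γ⟩
  · refine isLSConstant_depolarizing (by omega) hγ ?_ fun a => le_of_logSobolev_of_three_le hd
    have hd' : (3 : ℝ) ≤ d := by exact_mod_cast hd
    rw [tanhc_log_half (by linarith), sub_add_cancel]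
    ring
  · refine isLSConstant_depolarizing one_lt_two hγ ?_ fun a => le_of_logSobolev_two hγ
    norm_num [tanhc]
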